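/- Let $\mathfrak A$ be a (not necessarily unital) $C^*$-algebra, let $\mathscr H$ be a Hilbert $\mathfrak A$-module, let $\mathcal L(\mathscr H)$ be the $C^*$-algebra of adjointable operators on $\mathscr H$ with identity $I$, and write $|T|=(T^*T)^{1/2}$ for $T\in\mathcal L(\mathscr H)$. Let $\mathcal R(T)$ denote the range of $T$, and call a closed submodule $\mathscr M$ orthogonally complemented if $\mathscr H=\mathscr M+\mathscr M^\perp$; then $P_{\mathscr M}$ is the projection onto $\mathscr M$. An operator $T\in\mathcal L(\mathscr H)$ has the polar decomposition if $T=U|T|$ for some partial isometry $U\in\mathcal L(\mathscr H)$ such that $\overline{\mathcal R(T^*)}$ is orthogonally complemented and $U^*U=P_{\overline{\mathcal R(T^*)}}$. A pair $(P,Q)$, where $P\in\mathcal L(\mathscr H)$ is a projection ($P=P^*=P^2$) and $Q\in\mathcal L(\mathscr H)$ is an idempotent ($Q^2=Q$), is a quasi-projection pair if $PQ^*P=PQP$, $PQ^*(I-P)=-PQ(I-P)$ and $(I-P)Q^*(I-P)=(I-P)Q(I-P)$. A quasi-projection pair $(P,Q)$ is semi-harmonious if $P(I-Q)$ and $(I-P)Q$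 both have the polar decomposition, and harmonious if $\overline{\mathcal R(PQ(I-P))}$ and $\overline{\mathcal R((I-P)QP)}$ are both orthogonally complemented in $\mathscr H$. The matched projection of an idempotent $Q$ is $$m(Q)=\tfrac12\big(|Q^*|+Q^*\big)\,|Q^*|^\dagger\,\big(|Q^*|+I\big)^{-1}\big(|Q^*|+Q\big),$$ where $|Q^*|^\dagger$ is the Moore--Penrose inverse of $|Q^*|$. **Theorem.** For every idempotent $Q\in\mathcal L(\mathscr H)$, the matched pair $(m(Q),Q)$ is harmonious if and only if it is semi-harmonious. Moreover, $(m(Q),I-Q)$ is always semi-harmonious (in particular, it is a quasi-projection pair). -/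

import Mathlib

set_option linter.unusedSectionVars false

namespace HilbertCStar

/-! ### Adjointable operators on a Hilbert C*-module -/

section Adjointable

variable (A H : Type*) [NonUnitalCStarAlgebra A] [PartialOrder A] [StarOrderedRing A]
  [NormedAddCommGroup H] [NormedSpace ℂ H] [SMul A H] [CStarModule A H]

/-
Mathlib's `CStarModule A H` writes the `A`-action as `a • x`, with `⟨x, a • y⟩ = a * ⟨x, y⟩`.
A right Hilbert module over a C*-algebra `B` is the same thing as a `CStarModule` over the opposite
C*-algebra of `B`, so letting `A` range over all C*-algebras covers all right Hilbert modules.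
-/

/-- The bounded operators on `H` that possess an adjoint for the `A`-valued inner product, as a
subalgebra of the bounded operators. (A map that possesses an adjoint is automatically linear,
`A`-linear and bounded.) -/
noncomputable def adjointable : Subalgebra ℂ (H →L[ℂ] H) where
  carrier := {T | ∃ S : H →L[ℂ] H, ∀ x y : H, inner A (T x) y = inner A x (S y)}
  mul_mem' := by
    rintro T T' ⟨S, hS⟩ ⟨S', hS'⟩
    exact ⟨S' * S, fun x y => by simp [hS, hS']⟩
  add_mem' := by
    rintro T T' ⟨S, hS⟩ ⟨S', hS'⟩
    exact ⟨S + S', fun x y => by simp [hS, hS']⟩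
  algebraMap_mem' := fun c =>
    ⟨algebraMap ℂ (H →L[ℂ] H) (star c), fun x y => by simp [Algebra.algebraMap_eq_smul_one]⟩

/-- `𝓛(H)`: the adjointable operators on the Hilbert `A`-module `H`. -/
def AdjointableOp : Type _ := ↥(adjointable A H)

variable {A H}

namespace AdjointableOp

noncomputable instance : NormedRing (AdjointableOp A H) :=
  inferInstanceAs (NormedRing ↥(adjointable A H))

noncomputable instance : NormedAlgebra ℂ (AdjointableOp A H) :=
  inferInstanceAs (NormedAlgebra ℂ ↥(adjointable A H))

/-- The bounded operator underlying an adjointable operator. -/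
noncomputable def toCLM : AdjointableOp A H →ₐ[ℂ] (H →L[ℂ] H) := (adjointable A H).val

noncomputable instance : CoeFun (AdjointableOp A H) (fun _ => H → H) := ⟨fun T => toCLM T⟩

theorem toCLM_injective :
    Function.Injective (toCLM : AdjointableOp A H → (H →L[ℂ] H)) :=
  Subtype.val_injective

theorem norm_toCLM (T : AdjointableOp A H) : ‖toCLM T‖ = ‖T‖ := rfl

theorem op_ext {S T : AdjointableOp A H} (h : ∀ x, S x = T x) : S = T :=
  toCLM_injective (ContinuousLinearMap.ext h)

theorem exists_adjoint (T : AdjointableOp A H) :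
    ∃ S : H →L[ℂ] H, ∀ x y : H, inner A (T x) y = inner A x (S y) := T.2

/-- If `S` is an adjoint of `T`, then `T` is an adjoint of `S`. -/
theorem adjoint_symm {S T : H →L[ℂ] H} (h : ∀ x y : H, inner A (T x) y = inner A x (S y))
    (x y : H) : inner A (S x) y = inner A x (T y) := by
  rw [← CStarModule.star_inner (A := A) y (S x), ← h, CStarModule.star_inner]

/-- The adjoint of an adjointable operator. -/
noncomputable instance : Star (AdjointableOp A H) :=
  ⟨fun T => ⟨T.exists_adjoint.choose, toCLM T, adjoint_symm T.exists_adjoint.choose_spec⟩⟩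

/-- The defining property of the adjoint `star T`. -/
theorem inner_apply_left (T : AdjointableOp A H) (x y : H) :
    inner A (T x) y = inner A x (star T y) := T.exists_adjoint.choose_spec x y

theorem inner_apply_right (T : AdjointableOp A H) (x y : H) :
    inner A x (T y) = inner A (star T x) y :=
  (adjoint_symm (T.inner_apply_left) x y).symm

theorem ext_inner {x y : H} (h : ∀ z : H, inner A z x = inner A z y) : x = y := by
  have h' : inner A (x - y) (x - y) = 0 := by
    rw [CStarModule.inner_sub_right, h, sub_self]
  exact sub_eq_zero.mp (CStarModule.inner_self.mp h')

/-- The adjoint is uniquely determined by its defining property. -/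
theorem eq_star {S T : AdjointableOp A H} (h : ∀ x y : H, inner A (T x) y = inner A x (S y)) :
    S = star T :=
  op_ext fun y => ext_inner (A := A) fun z => by rw [← h, inner_apply_left]

noncomputable instance : StarRing (AdjointableOp A H) where
  star_involutive T := (eq_star fun x y => (inner_apply_right T x y).symm).symm
  star_mul S T := (eq_star fun x y => by simp [inner_apply_left]).symm
  star_add S T := (eq_star fun x y => by simp [inner_apply_left]).symm

instance : StarModule ℂ (AdjointableOp A H) where
  star_smul c T := (eq_star fun x y => by simp [inner_apply_left]).symm

theorem norm_sq_le (T : AdjointableOp A H) : ‖T‖ * ‖T‖ ≤ ‖star T * T‖ := by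
  have key : ∀ x : H, ‖T x‖ ≤ √‖star T * T‖ * ‖x‖ := fun x => by
    have h1 : ‖T x‖ ^ 2 ≤ ‖star T * T‖ * ‖x‖ ^ 2 :=
      calc ‖T x‖ ^ 2 = ‖inner A x ((star T * T) x)‖ := by
            rw [CStarModule.norm_sq_eq A, inner_apply_left]; simp
        _ ≤ ‖x‖ * ‖(star T * T) x‖ := CStarModule.norm_inner_le H
        _ ≤ ‖x‖ * (‖star T * T‖ * ‖x‖) := by
            gcongr
            exact (toCLM (star T * T)).le_opNorm x
        _ = ‖star T * T‖ * ‖x‖ ^ 2 := by ring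
    refine le_of_sq_le_sq ?_ (by positivity)
    rwa [mul_pow, Real.sq_sqrt (norm_nonneg _)]
  have h2 : ‖T‖ ≤ √‖star T * T‖ := (toCLM T).opNorm_le_bound (by positivity) key
  calc ‖T‖ * ‖T‖ ≤ √‖star T * T‖ * √‖star T * T‖ := by gcongr
    _ = ‖star T * T‖ := Real.mul_self_sqrt (norm_nonneg _)

instance : CStarRing (AdjointableOp A H) where
  norm_mul_self_le := norm_sq_le

instance [CompleteSpace H] : CompleteSpace (AdjointableOp A H) := by
  refine Metric.complete_of_cauchySeq_tendsto fun u hu => ?_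
  have hval : UniformContinuous (fun T : AdjointableOp A H => toCLM T) :=
    uniformContinuous_subtype_val
  have hstar : UniformContinuous (fun T : AdjointableOp A H => star T) :=
    (starₗᵢ ℂ (E := AdjointableOp A H)).isometry.uniformContinuous
  obtain ⟨T, hT⟩ := cauchySeq_tendsto_of_complete (hval.comp_cauchySeq hu)
  obtain ⟨S, hS⟩ := cauchySeq_tendsto_of_complete ((hval.comp hstar).comp_cauchySeq hu)
  have happ : ∀ {v : ℕ → H →L[ℂ] H} {R : H →L[ℂ] H} (x : H),
      Filter.Tendsto v Filter.atTop (nhds R) →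
      Filter.Tendsto (fun n => v n x) Filter.atTop (nhds (R x)) := fun x hv =>
    ((ContinuousLinearMap.apply ℂ H x).continuous.tendsto _).comp hv
  have hcont : Continuous (fun z : H × H => inner A z.1 z.2) := CStarModule.continuous_inner
  have hadj : ∀ x y : H, inner A (T x) y = inner A x (S y) := fun x y => by
    have h1 : Filter.Tendsto (fun n => inner A (u n x) y) Filter.atTop
        (nhds (inner A (T x) y)) :=
      (hcont.tendsto (T x, y)).comp ((happ x hT).prodMk_nhds tendsto_const_nhds)
    have h2 : Filter.Tendsto (fun n => inner A x (star (u n) y)) Filter.atTop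
        (nhds (inner A x (S y))) :=
      (hcont.tendsto (x, S y)).comp (tendsto_const_nhds.prodMk_nhds (happ y hS))
    refine tendsto_nhds_unique h1 (h2.congr fun n => ?_)
    exact (inner_apply_left (u n) x y).symm
  exact ⟨⟨T, S, hadj⟩, tendsto_subtype_rng.mpr hT⟩

/-- The adjointable operators on a Hilbert C*-module form a unital C*-algebra. -/
noncomputable instance [CompleteSpace H] : CStarAlgebra (AdjointableOp A H) where

/-- The order of the C*-algebra `𝓛(H)`: `S ≤ T` if `T - S` is self-adjoint with non-negative
spectrum. -/
noncomputable instance [CompleteSpace H] : PartialOrder (AdjointableOp A H) :=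
  CStarAlgebra.spectralOrder _

instance [CompleteSpace H] : StarOrderedRing (AdjointableOp A H) :=
  CStarAlgebra.spectralOrderedRing _

/-- Every map of `H` to itself that possesses an adjoint is an element of `𝓛(H)`. -/
theorem exists_eq_of_adjoint [CompleteSpace H] (f g : H → H)
    (h : ∀ x y : H, inner A (f x) y = inner A x (g y)) :
    ∃ T : AdjointableOp A H, ∀ x, T x = f x := by
  have symm : ∀ {f g : H → H}, (∀ x y : H, inner A (f x) y = inner A x (g y)) →
      ∀ x y : H, inner A x (f y) = inner A (g x) y := fun {f g} h x y => by
    rw [← CStarModule.star_inner (A := A) (f y) x, h, CStarModule.star_inner]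
  have bdd : ∀ {f g : H → H}, (∀ x y : H, inner A (f x) y = inner A x (g y)) →
      ∃ F : H →L[ℂ] H, ∀ x, F x = f x := fun {f g} h => by
    let L : H →ₗ[ℂ] H :=
      { toFun := f
        map_add' := fun x y => ext_inner (A := A) fun z => by
          simp only [symm h, CStarModule.inner_add_right]
        map_smul' := fun c x => ext_inner (A := A) fun z => by
          simp [symm h, CStarModule.inner_smul_right_complex] }
    have hcont : Continuous (fun z : H × H => inner A z.1 z.2) := CStarModule.continuous_inner
    refine ⟨⟨L, L.continuous_of_seq_closed_graph fun u x y hu hy => ?_⟩, fun x => rfl⟩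
    refine ext_inner (A := A) fun z => ?_
    have h1 : Filter.Tendsto (fun n => inner A z (f (u n))) Filter.atTop (nhds (inner A z y)) :=
      (hcont.tendsto (z, y)).comp (tendsto_const_nhds.prodMk_nhds hy)
    have h2 : Filter.Tendsto (fun n => inner A (g z) (u n)) Filter.atTop
        (nhds (inner A (g z) x)) :=
      (hcont.tendsto (g z, x)).comp (tendsto_const_nhds.prodMk_nhds hu)
    rw [tendsto_nhds_unique h1 (h2.congr fun n => (symm h z (u n)).symm)]
    exact (symm h z x).symm
  obtain ⟨F, hF⟩ := bdd h
  obtain ⟨G, hG⟩ := bdd (f := g) (g := f) fun x y => (symm h x y).symm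
  exact ⟨⟨F, G, fun x y => by rw [hF, hG, h]⟩, hF⟩

/-- The closure `cl R(T)` of the range of `T`. -/
noncomputable def rangeClosure (T : AdjointableOp A H) : Submodule ℂ H :=
  (LinearMap.range (toCLM T : H →ₗ[ℂ] H)).topologicalClosure

end AdjointableOp

variable (A) in
/-- `M^⊥ = {x | ⟨x, y⟩ = 0 for every y ∈ M}`. -/
def orthogonal (M : Submodule ℂ H) : Submodule ℂ H where
  carrier := {x | ∀ y ∈ M, inner A x y = 0}
  add_mem' := fun {x x'} hx hx' y hy => by simp [hx y hy, hx' y hy]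
  zero_mem' := fun y _ => by simp
  smul_mem' := fun c x hx y hy => by simp [hx y hy]

variable (A) in
/-- A (closed) submodule `M` is orthogonally complemented in `H` if `H = M + M^⊥`. -/
def IsOrthogonallyComplemented (M : Submodule ℂ H) : Prop :=
  M ⊔ orthogonal A M = ⊤

namespace AdjointableOp

/-- `p = P_M`: `p` is the projection of `H` onto `M`. -/
def IsProjectionOnto (p : AdjointableOp A H) (M : Submodule ℂ H) : Prop :=
  IsStarProjection p ∧ LinearMap.range (toCLM p : H →ₗ[ℂ] H) = M

/-- `T` has the polar decomposition: there is a partial isometry `U` with `T = U |T|` and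
`U* U = P_{cl R(T*)}`, where `|T|` is the square root of `T* T`. -/
def HasPolarDecomposition [CompleteSpace H] (T : AdjointableOp A H) : Prop :=
  ∃ U : AdjointableOp A H, U * star U * U = U ∧ T = U * CFC.abs T ∧
    IsProjectionOnto (star U * U) (rangeClosure (star T))

end AdjointableOp

end Adjointable

/-! ### Quasi-projection pairs and the matched projection -/

/-- `X` is the Moore-Penrose inverse of `T`. -/
structure IsMoorePenroseInverse {R : Type*} [Mul R] [Star R] (T X : R) : Prop where
  mul_mul_self : T * X * T = T
  mul_mul_inv : X * T * X = X
  isSelfAdjoint_left : IsSelfAdjoint (T * X)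
  isSelfAdjoint_right : IsSelfAdjoint (X * T)

theorem IsMoorePenroseInverse.unique {R : Type*} [Ring R] [StarRing R] {T X Y : R}
    (hX : IsMoorePenroseInverse T X) (hY : IsMoorePenroseInverse T Y) : X = Y := by
  have a1 : T * X = T * Y :=
    calc T * X = T * Y * (T * X) := by rw [← mul_assoc, hY.mul_mul_self]
      _ = star (T * Y) * star (T * X) := by
          rw [hX.isSelfAdjoint_left.star_eq, hY.isSelfAdjoint_left.star_eq]
      _ = star (T * X * T * Y) := by rw [← star_mul]; simp only [mul_assoc]
      _ = T * Y := by rw [hX.mul_mul_self, hY.isSelfAdjoint_left.star_eq]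
  have a2 : X * T = Y * T :=
    calc X * T = X * T * (Y * T) := by
          rw [mul_assoc X T, ← mul_assoc T Y T, hY.mul_mul_self]
      _ = star (X * T) * star (Y * T) := by
          rw [hX.isSelfAdjoint_right.star_eq, hY.isSelfAdjoint_right.star_eq]
      _ = star (Y * (T * X * T)) := by rw [← star_mul]; simp only [mul_assoc]
      _ = Y * T := by rw [hX.mul_mul_self, hY.isSelfAdjoint_right.star_eq]
  calc X = X * T * X := hX.mul_mul_inv.symm
    _ = Y * T * Y := by rw [a2, mul_assoc, a1, ← mul_assoc]
    _ = Y := hY.mul_mul_inv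

open Classical in
/-- The Moore-Penrose inverse of `T` (and `0` if `T` has none). It exists for `T = |Q*|` with
`Q` an idempotent, since then the range of `T` is closed. -/
noncomputable def moorePenroseInverse {R : Type*} [Mul R] [Star R] [Zero R] (T : R) : R :=
  if h : ∃ X, IsMoorePenroseInverse T X then h.choose else 0

/-- `(P, Q)` is a quasi-projection pair: `P` is a projection, `Q` an idempotent, and
`P Q* P = P Q P`, `P Q* (I - P) = - P Q (I - P)`, `(I - P) Q* (I - P) = (I - P) Q (I - P)`. -/
structure IsQuasiProjectionPair {R : Type*} [Ring R] [StarRing R] (P Q : R) : Prop where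
  isStarProjection : IsStarProjection P
  isIdempotentElem : IsIdempotentElem Q
  corner_left : P * star Q * P = P * Q * P
  off_diagonal : P * star Q * (1 - P) = -(P * Q * (1 - P))
  corner_right : (1 - P) * star Q * (1 - P) = (1 - P) * Q * (1 - P)

section Pairs

variable {A H : Type*} [NonUnitalCStarAlgebra A] [PartialOrder A] [StarOrderedRing A]
  [NormedAddCommGroup H] [NormedSpace ℂ H] [SMul A H] [CStarModule A H] [CompleteSpace H]

/-- The matched projection of an idempotent `Q`:
`m(Q) = (1/2) (|Q*| + Q*) |Q*|^† (|Q*| + I)^{-1} (|Q*| + Q)`. -/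
noncomputable def matchedProjection (Q : AdjointableOp A H) : AdjointableOp A H :=
  (1 / 2 : ℂ) • ((CFC.abs (star Q) + star Q) * moorePenroseInverse (CFC.abs (star Q)) *
    Ring.inverse (CFC.abs (star Q) + 1) * (CFC.abs (star Q) + Q))

/-- A quasi-projection pair `(P, Q)` is semi-harmonious if `P (I - Q)` and `(I - P) Q` both have
the polar decomposition. -/
structure IsSemiHarmonious (P Q : AdjointableOp A H) : Prop where
  isQuasiProjectionPair : IsQuasiProjectionPair P Q
  polar_left : (P * (1 - Q)).HasPolarDecomposition
  polar_right : ((1 - P) * Q).HasPolarDecomposition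

/-- A quasi-projection pair `(P, Q)` is harmonious if the closures of the ranges of
`P Q (I - P)` and `(I - P) Q P` are both orthogonally complemented in `H`. -/
structure IsHarmonious (P Q : AdjointableOp A H) : Prop where
  isQuasiProjectionPair : IsQuasiProjectionPair P Q
  complemented_left : IsOrthogonallyComplemented A (P * Q * (1 - P)).rangeClosure
  complemented_right : IsOrthogonallyComplemented A ((1 - P) * Q * P).rangeClosure

end Pairs

end HilbertCStar

/-! Write `P` for `m(Q)`. Three facts about `P` suffice (`matched_pair`): `(P, Q)` is a
quasi-projection pair, `Q = g P Q` for some `g`, and `1 - Q = (1 - Q) (1 - P) g'` for some `g'`.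
Being a pair means that `(2P - 1) Q` is self-adjoint, so the symmetry `2P - 1` exchanges `Q` and
`Q*`; this also turns the second fact into `Q = Q P g` for another `g`.

Hence `(1 - P) Q` and `(1 - P) Q P` have the same range closure, and so do `P (1 - Q)` and `P (1 -
Q) (1 - P) = -P Q (1 - P)`. A polar decomposition of `T` makes `cl R(T)` complemented, so
semi-harmonious implies harmonious. Conversely, `T` has a polar decomposition once `cl R(T)` and `cl
R(T*)` are complemented (`hasPolarDecomposition`). The adjoints are handled by
`isOrthogonallyComplemented_of_mul_eq`: by the symmetry, `Q* (1 - P)` and `P Q (1 - P)` are left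
multiples of each other.

For `(P, 1 - Q)` the relevant operators are `P Q` and `(1 - P) (1 - Q)`. The factorisations compare
them with `Q` and `1 - Q`, whose ranges are always complemented. -/

namespace HilbertCStar

/-! ### Idempotents of a C*-algebra and their range projections. -/

section Algebra

variable {R : Type*} [CStarAlgebra R] [PartialOrder R] [StarOrderedRing R]

theorem isUnit_one_add_of_nonneg {a : R} (ha : 0 ≤ a) : IsUnit (1 + a) :=
  CStarAlgebra.isUnit_of_le 1 (le_add_of_nonneg_right ha)

/-- For an idempotent `q`, the element `w` is the inverse of `1 + (q - q*) (q* - q)`. -/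
theorem exists_commute_mul_star_mul_eq {q : R} (hq : IsIdempotentElem q) :
    ∃ w : R, IsSelfAdjoint w ∧ Commute w q ∧ Commute w (star q) ∧ q * star q * q * w = q := by
  have hq1 : q * q = q := hq
  have hq2 : star q * star q = star q := by rw [← star_mul, hq1]
  have hq1' (x : R) : q * (q * x) = q * x := by rw [← mul_assoc, hq1]
  -- Expanded, `z = 1 - q - q* + q q* + q* q`, so multiplying by `q` on either side leaves `q q* q`.
  set z : R := 1 + star (star q - q) * (star q - q) with hz
  have hu : IsUnit z := isUnit_one_add_of_nonneg (star_mul_self_nonneg _)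
  have hsa : IsSelfAdjoint z := (IsSelfAdjoint.one R).add (IsSelfAdjoint.star_mul_self _)
  have hzq : z * q = q * star q * q := by
    simp only [hz, star_sub, star_star, mul_sub, sub_mul, add_mul, one_mul, mul_assoc, hq1, hq2]
    abel
  have hqz : q * z = q * star q * q := by
    simp only [hz, star_sub, star_star, mul_sub, sub_mul, mul_add, mul_one, mul_assoc, hq1, hq2,
      hq1']
    abel
  have hc : Commute z q := hzq.trans hqz.symm
  have hc' : Commute z (star q) := by
    have := hc.star_star
    rwa [hsa.star_eq] at this
  obtain ⟨u, hu⟩ := hu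
  have hsu : star u = u := Units.ext (by rw [Units.coe_star, hu, hsa.star_eq])
  refine ⟨↑u⁻¹, ?_, ?_, ?_, ?_⟩
  · rw [IsSelfAdjoint, ← Units.coe_star_inv, hsu]
  · exact Commute.units_inv_left (hu ▸ hc)
  · exact Commute.units_inv_left (hu ▸ hc')
  · rw [← hqz, ← hu, mul_assoc, Units.mul_inv, mul_one]

theorem IsMoorePenroseInverse.eq_moorePenroseInverse {T X : R} (h : IsMoorePenroseInverse T X) :
    moorePenroseInverse T = X := by
  have hex : ∃ X, IsMoorePenroseInverse T X := ⟨X, h⟩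
  rw [moorePenroseInverse, dif_pos hex]
  exact hex.choose_spec.unique h

/-- The range projection `p` of an idempotent `q`, and the Moore-Penrose inverse of `|q*|`. -/
theorem exists_isStarProjection_mul_eq {q : R} (hq : IsIdempotentElem q) :
    ∃ p : R, IsStarProjection p ∧ p * q = q ∧ q * p = p ∧
      IsMoorePenroseInverse (CFC.abs (star q)) (moorePenroseInverse (CFC.abs (star q))) ∧
      CFC.abs (star q) * moorePenroseInverse (CFC.abs (star q)) = p ∧
      moorePenroseInverse (CFC.abs (star q)) * CFC.abs (star q) = p ∧
      IsSelfAdjoint (moorePenroseInverse (CFC.abs (star q))) := by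
  obtain ⟨w, hw, hwq, hwq', h⟩ := exists_commute_mul_star_mul_eq hq
  have hq1 : q * q = q := hq
  set b := CFC.abs (star q) with hb
  have hbb : b * b = q * star q := by rw [hb, CFC.abs_mul_abs, star_star]
  have hbs : IsSelfAdjoint b := (CFC.abs_nonneg (star q)).isSelfAdjoint
  -- `b` is the square root of `q q*`, with which `w` commutes.
  have hbw : Commute w b := by
    rw [hb, CFC.abs]
    exact (Commute.cfcₙ_nnreal (by rw [star_star]; exact (hwq.mul_right hwq').symm) _).symm
  set p := q * star q * w with hp
  have hwqq : Commute w (q * star q) := hwq.mul_right hwq'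
  have hps : star p = p := by
    rw [hp, star_mul, star_mul, star_star, hw.star_eq, hwqq.eq]
  have hpq : p * q = q := by rw [hp, mul_assoc, hwq.eq, ← mul_assoc, h]
  have hqp : q * p = p := by rw [hp, ← mul_assoc, ← mul_assoc, hq1]
  have hpp : p * p = p := by
    nth_rw 2 [hp]
    rw [← mul_assoc, ← mul_assoc, hpq]
  have hbd : b * (b * w) = p := by rw [← mul_assoc, hbb]
  have hdb : b * w * b = p := by rw [mul_assoc, hbw.eq, hbd]
  have hpb : p * b = b := by
    have h0 : (1 - p) * b * star ((1 - p) * b) = 0 := by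
      rw [star_mul, hbs.star_eq, mul_assoc, ← mul_assoc b, hbb, ← mul_assoc, ← mul_assoc, sub_mul,
        hpq, one_mul, sub_self, zero_mul, zero_mul]
    have := (CStarRing.mul_star_self_eq_zero_iff _).mp h0
    rw [sub_mul, one_mul, sub_eq_zero] at this
    exact this.symm
  -- Both products of `b` with `b w` equal `b² w = q q* w = p`.
  have hmp : IsMoorePenroseInverse b (b * w) := by
    refine ⟨?_, ?_, ?_, ?_⟩
    · rw [hbd, hpb]
    · rw [hdb, ← mul_assoc, hpb]
    · rw [hbd]; exact hps
    · rw [hdb]; exact hps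
  rw [hmp.eq_moorePenroseInverse]
  refine ⟨p, ⟨hpp, hps⟩, hpq, hqp, hmp, hbd, hdb, ?_⟩
  rw [IsSelfAdjoint, star_mul, hbs.star_eq, hw.star_eq, hbw.eq]

end Algebra

/-! ### Quasi-projection pairs and the algebra of the matched projection. -/

section Algebra

variable {R : Type*} [CStarAlgebra R] [PartialOrder R] [StarOrderedRing R]

/-- The three identities compare `(2p - 1) q` with its adjoint `q* (2p - 1)` block by block relative
to `p`; the symmetry `2p - 1` acts as `1` on `p` and as `-1` on `1 - p`, which accounts for the
signs. -/
theorem isQuasiProjectionPair_of_isSelfAdjoint {p q : R} (hp : IsStarProjection p)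
    (hq : IsIdempotentElem q) (h : IsSelfAdjoint (2 * (p * q) - q)) :
    IsQuasiProjectionPair p q := by
  have hpp : p * p = p := hp.isIdempotentElem
  have e : 2 * (star q * p) - star q = 2 * (p * q) - q := by
    rw [← h.star_eq]
    simp [hp.isSelfAdjoint.star_eq, two_mul]
  have e1 : p * star q * p = p * q * p := by
    have := congr(p * $e * p)
    have h1 : p * (2 * (star q * p) - star q) * p = 2 * (p * star q * (p * p)) - p * star q * p := by
      noncomm_ring
    have h2 : p * (2 * (p * q) - q) * p = 2 * (p * p * q * p) - p * q * p := by noncomm_ring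
    rw [h1, h2, hpp] at this
    simpa only [two_mul, add_sub_cancel_right] using this
  refine ⟨hp, hq, e1, ?_, ?_⟩
  · have := congr(p * $e)
    have h1 : p * (2 * (star q * p) - star q) = 2 * (p * star q * p) - p * star q := by
      noncomm_ring
    have h2 : p * (2 * (p * q) - q) = 2 * (p * p * q) - p * q := by noncomm_ring
    rw [h1, h2, hpp, e1, two_mul, two_mul, add_sub_cancel_right] at this
    have h3 : p * star q = p * q * p + p * q * p - p * q :=
      eq_sub_of_add_eq (by rw [add_comm]; exact (sub_eq_iff_eq_add.mp this).symm)
    rw [mul_sub, mul_sub, e1, mul_one, mul_one, h3]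
    abel
  · have h0 : (1 - p) * p = 0 := hp.one_sub_mul_self
    have h0' : p * (1 - p) = 0 := hp.mul_one_sub_self
    have := congr(-((1 - p) * $e * (1 - p)))
    have h1 : -((1 - p) * (2 * (star q * p) - star q) * (1 - p)) =
        (1 - p) * star q * (1 - p) - 2 * ((1 - p) * star q * (p * (1 - p))) := by noncomm_ring
    have h2 : -((1 - p) * (2 * (p * q) - q) * (1 - p)) =
        (1 - p) * q * (1 - p) - 2 * ((1 - p) * p * q * (1 - p)) := by noncomm_ring
    rwa [h1, h2, h0, h0', mul_zero, mul_zero, zero_mul, zero_mul, mul_zero, sub_zero,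
      sub_zero] at this

/-- The matched pair of an idempotent is a quasi-projection pair, `q` factors through `m q`, and
`1 - q` factors through `(1 - q) (1 - m)`. -/
theorem matched_pair {q : R} (hq : IsIdempotentElem q) {m : R}
    (hm : m = (1 / 2 : ℂ) • ((CFC.abs (star q) + star q) * moorePenroseInverse (CFC.abs (star q)) *
      Ring.inverse (CFC.abs (star q) + 1) * (CFC.abs (star q) + q))) :
    IsQuasiProjectionPair m q ∧ (∃ g, g * m * q = q) ∧
      ∃ g, (1 - q) * (1 - m) * g = 1 - q := by
  obtain ⟨p, hp, hpq, hqp, hmp, hbd, hdb, hds⟩ := exists_isStarProjection_mul_eq hq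
  have hq1 : q * q = q := hq
  have hbb : CFC.abs (star q) * CFC.abs (star q) = q * star q := by rw [CFC.abs_mul_abs, star_star]
  have hb0 : 0 ≤ CFC.abs (star q) := CFC.abs_nonneg _
  generalize CFC.abs (star q) = b at *
  generalize moorePenroseInverse b = d at *
  have hbs : star b = b := hb0.isSelfAdjoint.star_eq
  have hps : star p = p := hp.isSelfAdjoint.star_eq
  have hu : IsUnit (b + 1) := add_comm 1 b ▸ isUnit_one_add_of_nonneg hb0
  have hbc : (b + 1) * Ring.inverse (b + 1) = 1 := Ring.mul_inverse_cancel _ hu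
  have hcb : Ring.inverse (b + 1) * (b + 1) = 1 := Ring.inverse_mul_cancel _ hu
  generalize Ring.inverse (b + 1) = c at *
  have hcom {x : R} (h : Commute b x) : c * x = x * c := by
    have hx : (b + 1) * x = x * (b + 1) := by rw [add_mul, mul_add, h.eq, one_mul, mul_one]
    calc c * x = c * (x * (b + 1)) * c := by rw [mul_assoc, mul_assoc, hbc, mul_one]
      _ = x * c := by rw [← hx, ← mul_assoc, hcb, one_mul]
  have hcs : star c = c := by
    have h1 : star c * (b + 1) = 1 := by simpa [hbs] using congr(star $hbc)
    calc star c = star c * ((b + 1) * c) := by rw [hbc, mul_one]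
      _ = c := by rw [← mul_assoc, h1, one_mul]
  have hc0 : 0 ≤ c := by
    have : star c * (b + 1) * c = c := by rw [mul_assoc, hbc, mul_one, hcs]
    rw [← this]
    exact star_left_conjugate_nonneg (add_nonneg hb0 zero_le_one) c
  have hpb : p * b = b := by rw [← hbd, hmp.mul_mul_self]
  have hpd : p * d = d := by rw [← hdb, hmp.mul_mul_inv]
  have hqb : q * b = b := by rw [← hpb, ← mul_assoc, hqp]
  have hbq : b * star q = b := by simpa [hbs] using congr(star $hqb)
  have hcbd : c * b = b * c := hcom (Commute.refl b)
  have hcd : c * d = d * c := hcom (hbd.trans hdb.symm)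
  set n := (b + star q) * d * c * (b + q) with hn
  -- The identity behind the formula for `m`: the factors `d` and `c` cancel `b` (up to `p`) and `b
  -- + 1`, so `n² = 2n` and `n / 2` is a projection.
  have hVV : (b + q) * (b + star q) = 2 * (b * (b + 1)) := by
    rw [add_mul, mul_add, mul_add, hbq, hqb, ← hbb]; noncomm_ring
  have hnn : n * n = 2 * n := by
    calc n * n = (b + star q) * d * c * ((b + q) * (b + star q)) * d * c * (b + q) := by
          simp only [hn, mul_assoc]
      _ = 2 * ((b + star q) * (d * (c * b) * (b + 1) * d * c) * (b + q)) := by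
          rw [hVV]; noncomm_ring
      _ = 2 * n := by
          rw [hcbd, ← mul_assoc d, hdb, mul_assoc p, hcb, mul_one, hpd, ← mul_assoc _ d c, hn]
  have hns : star n = n := by
    simp [hn, hbs, hds.star_eq, hcs, ← hcd, mul_assoc]
  have hnq : n * q = (b + star q) * d * q := by
    have : (b + q) * q = (b + 1) * q := by rw [add_mul, hq1, add_mul, one_mul]
    rw [hn, mul_assoc _ _ q, this, mul_assoc _ c, ← mul_assoc c, hcb, one_mul]
  have h2 : (2 : R) = (2 : ℂ) • 1 := by rw [two_smul]; norm_num
  have h2m : 2 * m = n := by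
    rw [hm, h2, smul_mul_smul_comm, one_mul]; norm_num
  have hms : star m = m := by rw [hm, star_smul, hns]; norm_num
  have hmm : m * m = m := by
    have : m = (1 / 2 : ℂ) • n := hm
    rw [this, smul_mul_smul_comm, hnn, h2, smul_mul_assoc, one_mul, smul_smul]; norm_num
  have hqV : q * (b + star q) = (1 + b) * b := by
    rw [mul_add, hqb, ← hbb, add_mul, one_mul]
  -- As `n = 2m` and `c` inverts `1 + b`, this yields `(c q 2) m q = q`.
  have hqnq : q * n * q = (1 + b) * q := by
    rw [mul_assoc, hnq, ← mul_assoc, ← mul_assoc, hqV, mul_assoc (1 + b), hbd, mul_assoc, hpq]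
  refine ⟨isQuasiProjectionPair_of_isSelfAdjoint ⟨hmm, hms⟩ hq ?_, ⟨c * q * 2, ?_⟩, ?_⟩
  -- `2mq - q = n q - q = q* d q`, and `d` is self-adjoint.
  · rw [← mul_assoc, h2m, hnq, add_mul, hbd, add_mul, hpq, add_sub_cancel_left]
    simp [IsSelfAdjoint, hds.star_eq, mul_assoc]
  · rw [mul_assoc _ 2 m, h2m, mul_assoc c, mul_assoc c, hqnq, add_comm 1 b, ← mul_assoc, hcb,
      one_mul]
  -- Compressing `n` by `1 - q` gives `-(1 - q) a* c a`. Thus `(1 - q) (1 - m) (1 - q) = (1 - q) u`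
  -- with `u = 1 + a* c a / 2`, which is invertible because `c ≥ 0`.
  · set a := q - p with ha
    have ha0 : 0 ≤ (1 / 2 : ℝ) • (star a * c * a) :=
      smul_nonneg (by norm_num) (star_left_conjugate_nonneg hc0 a)
    obtain ⟨u, hu⟩ := isUnit_one_add_of_nonneg ha0
    have h2u : 2 * (u : R) = 2 + star a * c * a := by
      rw [hu, mul_add, mul_one, two_mul ((1 / 2 : ℝ) • _), ← add_smul]; norm_num
    have hV1 : (1 - q) * (b + star q) = (1 - q) * star a := by
      rw [ha, star_sub, hps, mul_sub, sub_mul _ _ p, hqp, one_mul, sub_self, sub_zero, mul_add,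
        sub_mul _ _ b, hqb, one_mul, sub_self, zero_add]
    have hV2 : (b + q) * (1 - q) = b * (1 - q) := by
      rw [add_mul, mul_sub q, hq1, mul_one, sub_self, add_zero]
    have hpa : p * (1 - q) = -a := by rw [mul_sub, hpq, mul_one, ha, neg_sub]
    have hnW : (1 - q) * n * (1 - q) = -((1 - q) * star a * c * a) := by
      calc (1 - q) * n * (1 - q)
          = ((1 - q) * (b + star q)) * d * c * ((b + q) * (1 - q)) := by
            simp only [hn, mul_assoc]
        _ = (1 - q) * star a * ((d * c) * b) * (1 - q) := by
            rw [hV1, hV2]; simp only [mul_assoc]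
        _ = -((1 - q) * star a * c * a) := by
            rw [← hcd, mul_assoc c, hdb, mul_assoc, mul_assoc c, hpa]; noncomm_ring
    have hW : (1 - q) * (1 - m) * (1 - q) = (1 - q) * u := by
      have h1q : (1 - q) * (1 - q) = 1 - q := hq.one_sub
      have : 2 * ((1 - q) * (1 - m) * (1 - q)) = 2 * ((1 - q) * u) := by
        calc 2 * ((1 - q) * (1 - m) * (1 - q))
            = 2 * ((1 - q) * (1 - q)) - (1 - q) * (2 * m) * (1 - q) := by noncomm_ring
          _ = (1 - q) * (2 * u) := by rw [h2m, hnW, h1q, h2u]; noncomm_ring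
          _ = 2 * ((1 - q) * u) := by noncomm_ring
      have h22 : ((1 / 2 : ℂ) • (1 : R)) * 2 = 1 := by
        rw [h2, smul_mul_smul_comm]; norm_num
      simpa only [← mul_assoc, h22, one_mul] using congr(((1 / 2 : ℂ) • (1 : R)) * $this)
    exact ⟨(1 - q) * ↑u⁻¹, by rw [← mul_assoc, hW, mul_assoc, Units.mul_inv, mul_one]⟩

namespace IsQuasiProjectionPair

variable {p q : R}

/-- Reassembles the blocks; the lower-left one comes from the adjoint of the off-diagonal identity.
-/
theorem isSelfAdjoint (h : IsQuasiProjectionPair p q) : IsSelfAdjoint (2 * (p * q) - q) := by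
  have hp : star p = p := h.isStarProjection.isSelfAdjoint.star_eq
  have e : (1 - p) * star q * p = -((1 - p) * q * p) := by
    have := congr(-star $(h.off_diagonal))
    simpa [hp, mul_assoc] using this.symm
  calc star (2 * (p * q) - q) = 2 * (star q * p) - star q := by simp [hp, two_mul]
    _ = p * star q * p + (1 - p) * star q * p - p * star q * (1 - p)
          - (1 - p) * star q * (1 - p) := by noncomm_ring
    _ = 2 * (p * q) - q := by
      rw [e, h.corner_left, h.off_diagonal, h.corner_right]; noncomm_ring

theorem one_sub (h : IsQuasiProjectionPair p q) : IsQuasiProjectionPair (1 - p) (1 - q) := by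
  refine isQuasiProjectionPair_of_isSelfAdjoint h.isStarProjection.one_sub
    h.isIdempotentElem.one_sub ?_
  have : 2 * ((1 - p) * (1 - q)) - (1 - q) = 1 - (p + p) + (2 * (p * q) - q) := by noncomm_ring
  have hp := h.isStarProjection.isSelfAdjoint
  rw [this]
  exact ((IsSelfAdjoint.one R).sub (hp.add hp)).add h.isSelfAdjoint

/-- `2 p - 1` intertwines `q` and `q*`. -/
theorem star_mul_eq (h : IsQuasiProjectionPair p q) :
    star q * (2 * p - 1) = (2 * p - 1) * q := by
  have hp : star p = p := h.isStarProjection.isSelfAdjoint.star_eq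
  calc star q * (2 * p - 1) = star (2 * (p * q) - q) := by simp [hp, two_mul, mul_sub, mul_add]
    _ = (2 * p - 1) * q := by rw [h.isSelfAdjoint.star_eq]; noncomm_ring

theorem reflection_mul_self (h : IsQuasiProjectionPair p q) : (2 * p - 1) * (2 * p - 1) = 1 := by
  have hpp : p * p = p := h.isStarProjection.isIdempotentElem
  calc (2 * p - 1) * (2 * p - 1) = 4 * (p * p) - 4 * p + 1 := by noncomm_ring
    _ = 1 := by rw [hpp]; noncomm_ring

/-- Take adjoints and conjugate by `2p - 1`, which commutes with `p` and exchanges `q*` and `q`. -/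
theorem exists_mul_mul_eq_of_right (h : IsQuasiProjectionPair p q) (hg : ∃ g, q * p * g = q) :
    ∃ g, g * p * q = q := by
  obtain ⟨g, hg⟩ := hg
  have hp : star p = p := h.isStarProjection.isSelfAdjoint.star_eq
  have h1 : star g * p * star q = star q := by simpa [hp, mul_assoc] using congr(star $hg)
  have h2 : (2 * p - 1) * p = p * (2 * p - 1) := by noncomm_ring
  refine ⟨(2 * p - 1) * star g * (2 * p - 1), ?_⟩
  calc (2 * p - 1) * star g * (2 * p - 1) * p * q
      = (2 * p - 1) * star g * p * ((2 * p - 1) * q) := by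
        rw [mul_assoc _ _ p, h2]; simp only [mul_assoc]
    _ = (2 * p - 1) * (star g * p * star q) * (2 * p - 1) := by
        rw [← h.star_mul_eq]; simp only [mul_assoc]
    _ = q := by rw [h1, mul_assoc, h.star_mul_eq, ← mul_assoc, h.reflection_mul_self, one_mul]

theorem exists_mul_mul_eq_of_left (h : IsQuasiProjectionPair p q) (hg : ∃ g, g * p * q = q) :
    ∃ g, q * p * g = q := by
  obtain ⟨g, hg⟩ := hg
  have hp : star p = p := h.isStarProjection.isSelfAdjoint.star_eq
  have h1 : star q * (p * star g) = star q := by simpa [hp, mul_assoc] using congr(star $hg)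
  have h2 : (2 * p - 1) * p = p * (2 * p - 1) := by noncomm_ring
  have h3 : q * (2 * p - 1) = (2 * p - 1) * star q := by
    have hs := h.reflection_mul_self
    calc q * (2 * p - 1) = (2 * p - 1) * ((2 * p - 1) * q) * (2 * p - 1) := by
          rw [← mul_assoc, hs, one_mul]
      _ = (2 * p - 1) * star q := by
          rw [← h.star_mul_eq, mul_assoc, mul_assoc (star q), hs, mul_one]
  refine ⟨(2 * p - 1) * star g * (2 * p - 1), ?_⟩
  calc q * p * ((2 * p - 1) * star g * (2 * p - 1))
      = q * (2 * p - 1) * (p * star g) * (2 * p - 1) := by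
        rw [mul_assoc q (2 * p - 1), ← mul_assoc (2 * p - 1) p, h2]; simp only [mul_assoc]
    _ = (2 * p - 1) * (star q * (p * star g)) * (2 * p - 1) := by rw [h3]; simp only [mul_assoc]
    _ = q := by rw [h1, mul_assoc, h.star_mul_eq, ← mul_assoc, h.reflection_mul_self, one_mul]

end IsQuasiProjectionPair
end Algebra

/-! ### Analytic tools: bounded resolvents and pointwise Cauchy sequences. -/

section Resolvent

variable {R : Type*} [CStarAlgebra R] [PartialOrder R] [StarOrderedRing R]

/-- `r` is `(k + ε)⁻¹`; the bound is `x / (x + ε) ≤ 1` on the spectrum. -/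
theorem exists_resolvent {k : R} (hk : 0 ≤ k) {ε : ℝ} (hε : 0 < ε) :
    ∃ r : R, IsSelfAdjoint r ∧ Commute k r ∧ k * r + ε • r = 1 ∧ ‖k * r‖ ≤ 1 := by
  have hsp : ∀ x ∈ spectrum ℝ k, 0 ≤ x := fun x hx => spectrum_nonneg_of_nonneg hk hx
  have hcont : ContinuousOn (fun x : ℝ => (x + ε)⁻¹) (spectrum ℝ k) :=
    ContinuousOn.inv₀ (by fun_prop) fun x hx => by have := hsp x hx; positivity
  have hka : IsSelfAdjoint k := hk.isSelfAdjoint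
  have hmul : k * cfc (fun x : ℝ => (x + ε)⁻¹) k = cfc (fun x : ℝ => x * (x + ε)⁻¹) k := by
    conv_lhs => rw [← cfc_id' ℝ k]
    rw [cfc_id' ℝ k, cfc_mul (fun x : ℝ => x) _ k (by fun_prop) hcont, cfc_id' ℝ k]
  refine ⟨cfc (fun x : ℝ => (x + ε)⁻¹) k, cfc_predicate _ k, ?_, ?_, ?_⟩
  · exact (Commute.refl k).cfc_real _ |>.symm
  · rw [hmul, ← cfc_smul ε _ k hcont, ← cfc_add k _ _ (by fun_prop) (by fun_prop),
      ← cfc_one ℝ k]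
    refine cfc_congr fun x hx => ?_
    have := hsp x hx
    simp only [smul_eq_mul, Pi.one_apply]
    field_simp
  · rw [hmul]
    refine norm_cfc_le zero_le_one fun x hx => ?_
    have := hsp x hx
    rw [Real.norm_of_nonneg (by positivity), ← div_eq_mul_inv]
    exact div_le_one_of_le₀ (by linarith) (by positivity)

theorem norm_eq_of_star_mul_self_eq {a b : R} (h : star a * a = star b * b) : ‖a‖ = ‖b‖ := by
  have : ‖a‖ * ‖a‖ = ‖b‖ * ‖b‖ := by
    rw [← CStarRing.norm_star_mul_self, ← CStarRing.norm_star_mul_self, h]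
  exact (mul_self_inj (norm_nonneg _) (norm_nonneg _)).mp this

end Resolvent

section Closure

variable {E : Type*} [NormedAddCommGroup E] [NormedSpace ℂ E]

/-- The vectors on which a uniformly bounded sequence of operators is Cauchy form a closed
subspace. -/
def cauchySubmodule (u : ℕ → E →L[ℂ] E) : Submodule ℂ E where
  carrier := {x | CauchySeq fun n => u n x}
  add_mem' := fun hx hy => by
    simp only [Set.mem_ofPred_eq, map_add] at *
    exact hx.add hy
  zero_mem' := by simpa using cauchySeq_const 0
  smul_mem' := fun c x hx => by
    simp only [Set.mem_ofPred_eq, map_smul] at *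
    exact (uniformContinuous_const_smul c).comp_cauchySeq hx

theorem isClosed_cauchySubmodule {u : ℕ → E →L[ℂ] E} (hu : ∀ n, ‖u n‖ ≤ 1) :
    IsClosed (cauchySubmodule u : Set E) := by
  refine isClosed_of_closure_subset fun x hx => ?_
  refine Metric.cauchySeq_iff'.mpr fun ε hε => ?_
  obtain ⟨y, hy, hxy⟩ := Metric.mem_closure_iff.mp hx (ε / 3) (by positivity)
  obtain ⟨N, hN⟩ := Metric.cauchySeq_iff'.mp hy (ε / 3) (by positivity)
  have key (n : ℕ) : dist (u n x) (u n y) ≤ dist x y := by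
    rw [dist_eq_norm, dist_eq_norm, ← map_sub]
    simpa using (u n).le_of_opNorm_le (hu n) (x - y)
  refine ⟨N, fun n hn => ?_⟩
  calc dist (u n x) (u N x) ≤ dist (u n x) (u n y) + dist (u n y) (u N y) + dist (u N y) (u N x) :=
        dist_triangle4 _ _ _ _
    _ < ε / 3 + ε / 3 + ε / 3 := by
        have h1 := key n
        have h2 := key N
        rw [dist_comm] at h2
        have h3 := hN n hn
        linarith
    _ = ε := by ring

end Closure

/-! ### Range closures and orthogonal complements. -/

section Module

variable {A H : Type*} [NonUnitalCStarAlgebra A] [PartialOrder A] [StarOrderedRing A]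
  [NormedAddCommGroup H] [NormedSpace ℂ H] [SMul A H] [CStarModule A H]

namespace AdjointableOp

theorem mul_apply (S T : AdjointableOp A H) (x : H) : (S * T) x = S (T x) := by simp

theorem apply_mem_rangeClosure (T : AdjointableOp A H) (x : H) : T x ∈ T.rangeClosure :=
  Submodule.le_topologicalClosure _ ⟨x, rfl⟩

theorem rangeClosure_le {T : AdjointableOp A H} {N : Submodule ℂ H} (hN : IsClosed (N : Set H))
    (h : ∀ x, T x ∈ N) : T.rangeClosure ≤ N :=
  Submodule.topologicalClosure_minimal _ (by rintro _ ⟨x, rfl⟩; exact h x) hN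

theorem isClosed_rangeClosure (T : AdjointableOp A H) : IsClosed (T.rangeClosure : Set H) :=
  Submodule.isClosed_topologicalClosure _

theorem rangeClosure_mul_le (S T : AdjointableOp A H) :
    (S * T).rangeClosure ≤ S.rangeClosure :=
  rangeClosure_le S.isClosed_rangeClosure fun x => by
    rw [mul_apply]; exact S.apply_mem_rangeClosure _

theorem apply_mem_rangeClosure_mul (S : AdjointableOp A H) {T : AdjointableOp A H} {x : H}
    (hx : x ∈ T.rangeClosure) : S x ∈ (S * T).rangeClosure := by
  have : T.rangeClosure ≤ (S * T).rangeClosure.comap (toCLM S : H →ₗ[ℂ] H) :=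
    rangeClosure_le ((S * T).isClosed_rangeClosure.preimage (toCLM S).continuous) fun x => by
      have := (S * T).apply_mem_rangeClosure x
      rwa [mul_apply] at this
  exact this hx

theorem rangeClosure_neg (T : AdjointableOp A H) : (-T).rangeClosure = T.rangeClosure :=
  le_antisymm (by simpa using rangeClosure_mul_le T (-1))
    (by simpa using rangeClosure_mul_le (-T) (-1))

theorem mem_orthogonal_rangeClosure {T : AdjointableOp A H} {x : H} :
    x ∈ orthogonal A T.rangeClosure ↔ star T x = 0 := by
  constructor
  · intro h
    refine CStarModule.inner_self.mp (?_ : inner A _ _ = 0)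
    rw [← inner_apply_right]
    exact h _ (T.apply_mem_rangeClosure _)
  · intro h y hy
    have hcont : Continuous (fun z : H × H => inner A z.1 z.2) := CStarModule.continuous_inner
    refine (isClosed_singleton.preimage (hcont.comp (Continuous.prodMk_right x))).closure_subset_iff.mpr
      (?_ : _ ⊆ {y | inner A x y = 0}) hy
    rintro _ ⟨z, rfl⟩
    change inner A x (T z) = 0
    rw [inner_apply_right, h, CStarModule.inner_zero_left]

end AdjointableOp

theorem isOrthogonallyComplemented_iff {M : Submodule ℂ H} :
    IsOrthogonallyComplemented A M ↔ ∀ x, ∃ y ∈ M, x - y ∈ orthogonal A M := by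
  simp only [IsOrthogonallyComplemented, Submodule.eq_top_iff', Submodule.mem_sup]
  refine forall_congr' fun x => ⟨?_, ?_⟩
  · rintro ⟨y, hy, z, hz, rfl⟩
    exact ⟨y, hy, by simpa using hz⟩
  · rintro ⟨y, hy, h⟩
    exact ⟨y, hy, _, h, add_sub_cancel _ _⟩

namespace AdjointableOp

theorem IsProjectionOnto.isOrthogonallyComplemented {p : AdjointableOp A H} {M : Submodule ℂ H}
    (h : p.IsProjectionOnto M) : IsOrthogonallyComplemented A M := by
  obtain ⟨hp, rfl⟩ := h
  refine isOrthogonallyComplemented_iff.mpr fun x => ⟨p x, ⟨x, rfl⟩, ?_⟩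
  rintro _ ⟨y, rfl⟩
  change inner A (x - p x) (p y) = 0
  rw [inner_apply_right, hp.isSelfAdjoint.star_eq, map_sub, ← mul_apply,
    hp.isIdempotentElem.eq, sub_self, CStarModule.inner_zero_left]

theorem IsProjectionOnto.apply_eq {p : AdjointableOp A H} {M : Submodule ℂ H}
    (h : p.IsProjectionOnto M) {x : H} (hx : x ∈ M) : p x = x := by
  obtain ⟨hp, rfl⟩ := h
  obtain ⟨y, rfl⟩ := hx
  change p (p y) = p y
  rw [← mul_apply, hp.isIdempotentElem.eq]

theorem IsProjectionOnto.apply_mem {p : AdjointableOp A H} {M : Submodule ℂ H}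
    (h : p.IsProjectionOnto M) (x : H) : p x ∈ M := h.2 ▸ ⟨x, rfl⟩

theorem rangeClosure_eq_range {e : AdjointableOp A H} (he : IsIdempotentElem e) :
    e.rangeClosure = LinearMap.range (toCLM e : H →ₗ[ℂ] H) := by
  refine le_antisymm (rangeClosure_le ?_ fun x => ⟨x, rfl⟩) (Submodule.le_topologicalClosure _)
  have : ((LinearMap.range (toCLM e : H →ₗ[ℂ] H) : Submodule ℂ H) : Set H) = {x | e x = x} := by
    ext x
    constructor
    · rintro ⟨y, rfl⟩
      change e (e y) = e y
      rw [← mul_apply, he.eq]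
    · exact fun h => ⟨x, h⟩
  rw [this]
  exact isClosed_eq (toCLM e).continuous continuous_id

variable [CompleteSpace H]

/-- The map sending `x` to its component in `M` is its own adjoint, and a map with an adjoint is
automatically linear and bounded. -/
theorem exists_isProjectionOnto {M : Submodule ℂ H} (h : IsOrthogonallyComplemented A M) :
    ∃ p : AdjointableOp A H, p.IsProjectionOnto M := by
  choose f hf hf' using isOrthogonallyComplemented_iff.mp h
  have key (x y : H) : inner A (f x) y = inner A (f x) (f y) := by
    have : inner A (f x) (y - f y) = 0 := by
      rw [← CStarModule.star_inner, hf' y _ (hf x), star_zero]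
    rwa [CStarModule.inner_sub_right, sub_eq_zero] at this
  have key' (x y : H) : inner A x (f y) = inner A (f x) (f y) := by
    have : inner A (x - f x) (f y) = 0 := hf' x _ (hf y)
    rwa [CStarModule.inner_sub_left, sub_eq_zero] at this
  obtain ⟨p, hp⟩ := exists_eq_of_adjoint f f fun x y => (key x y).trans (key' x y).symm
  have hps : p = star p := eq_star fun x y => by rw [hp, hp, key, ← key']
  have hfM {x : H} (hx : x ∈ M) : f x = x := by
    have h1 : x - f x ∈ M := M.sub_mem hx (hf x)
    have : inner A (x - f x) (x - f x) = 0 := hf' x _ h1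
    exact (sub_eq_zero.mp (CStarModule.inner_self.mp this)).symm
  refine ⟨p, ⟨op_ext fun x => ?_, hps.symm⟩, ?_⟩
  · rw [mul_apply, hp, hp, hfM (hf x)]
  · ext x
    constructor
    · rintro ⟨y, rfl⟩
      exact (hp y).symm ▸ hf y
    · exact fun hx => ⟨x, (hp x).trans (hfM hx)⟩

/-- `p e = e` and `e p = p` give `e` the same range as its range projection `p`. -/
theorem isOrthogonallyComplemented_of_isIdempotentElem {e : AdjointableOp A H}
    (he : IsIdempotentElem e) : IsOrthogonallyComplemented A e.rangeClosure := by
  obtain ⟨p, hp, hpe, hep, -⟩ := exists_isStarProjection_mul_eq he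
  have : e.rangeClosure = p.rangeClosure := by
    refine le_antisymm ?_ ?_
    · rw [← hpe]; exact rangeClosure_mul_le _ _
    · rw [← hep]; exact rangeClosure_mul_le _ _
  rw [this, rangeClosure_eq_range hp.isIdempotentElem]
  exact IsProjectionOnto.isOrthogonallyComplemented ⟨hp, rfl⟩

/-- Complementedness of the closure of the range passes to a left multiple from which the operator
can be recovered. -/
theorem isOrthogonallyComplemented_of_mul_eq {S T a b : AdjointableOp A H} (hS : S = a * T)
    (hT : T = b * S) (h : IsOrthogonallyComplemented A T.rangeClosure) :
    IsOrthogonallyComplemented A S.rangeClosure := by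
  obtain ⟨p, hp⟩ := exists_isProjectionOnto h
  have hpT : p * T = T := op_ext fun x => by
    rw [mul_apply, hp.apply_eq (T.apply_mem_rangeClosure x)]
  -- `b a` fixes `R(T)`, hence by continuity its closure. This makes `a p b` an idempotent whose
  -- range is `cl R(S)`.
  have hba : T.rangeClosure ≤
      LinearMap.eqLocus (toCLM (b * a) : H →ₗ[ℂ] H) LinearMap.id :=
    rangeClosure_le (isClosed_eq (toCLM (b * a)).continuous continuous_id) fun x => by
      change (b * a) (T x) = T x
      rw [← mul_apply, mul_assoc, ← hS, ← hT]
  have hbap : b * (a * p) = p := op_ext fun x => by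
    rw [← mul_assoc, mul_apply]
    exact hba (hp.apply_mem x)
  have he : IsIdempotentElem (a * p * b) := by
    have hpp : p * p = p := hp.1.isIdempotentElem
    calc a * p * b * (a * p * b) = a * p * (b * (a * p)) * b := by simp only [mul_assoc]
      _ = a * p * b := by rw [hbap, mul_assoc a, hpp]
  have heS : a * p * b * S = S := by rw [mul_assoc, ← hT, mul_assoc, hpT, ← hS]
  have : S.rangeClosure = (a * p * b).rangeClosure := by
    refine le_antisymm ?_ (rangeClosure_le S.isClosed_rangeClosure fun x => ?_)
    · nth_rw 1 [← heS]
      exact rangeClosure_mul_le _ _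
    · rw [mul_apply, mul_apply, hS]
      exact a.apply_mem_rangeClosure_mul (hp.apply_mem _)
  rw [this]
  exact isOrthogonallyComplemented_of_isIdempotentElem he

/-- `cl R(T)` is the range of the projection `U U*`: the range of `U* U` is `cl R(T*)`, which lies
in `cl R(|T|)`, and `U` maps the latter into `cl R(U |T|)`. -/
theorem HasPolarDecomposition.isOrthogonallyComplemented {T : AdjointableOp A H}
    (h : T.HasPolarDecomposition) : IsOrthogonallyComplemented A T.rangeClosure := by
  obtain ⟨U, hU, hT, hUU⟩ := h
  have hk : star (CFC.abs T) = CFC.abs T := (CFC.abs_nonneg T).isSelfAdjoint.star_eq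
  have hT' : star T = CFC.abs T * star U := by
    nth_rw 1 [hT]
    rw [star_mul, hk]
  have he : IsIdempotentElem (U * star U) := by
    rw [IsIdempotentElem, ← mul_assoc, hU]
  have : T.rangeClosure = (U * star U).rangeClosure := by
    refine le_antisymm ?_ (rangeClosure_le T.isClosed_rangeClosure fun x => ?_)
    · have h0 : U * star U * T = T := by
        conv_lhs => rw [hT, ← mul_assoc, hU]
        exact hT.symm
      nth_rw 1 [← h0]
      exact rangeClosure_mul_le _ _
    · have h1 : (star U * U) (star U x) ∈ (CFC.abs T).rangeClosure := by
        have := hUU.apply_mem (star U x)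
        rw [hT'] at this
        exact rangeClosure_mul_le _ _ this
      have h2 := U.apply_mem_rangeClosure_mul h1
      rwa [← hT, ← mul_apply, ← mul_apply, ← mul_assoc, hU] at h2
  rw [this]
  exact isOrthogonallyComplemented_of_isIdempotentElem he

end AdjointableOp
end Module
-- Existence of the polar decomposition.
section Module

variable {A H : Type*} [NonUnitalCStarAlgebra A] [PartialOrder A] [StarOrderedRing A]
  [NormedAddCommGroup H] [NormedSpace ℂ H] [SMul A H] [CStarModule A H] [CompleteSpace H]

namespace AdjointableOp
open Filter Topology

theorem tendsto_apply {u : ℕ → AdjointableOp A H} {T : AdjointableOp A H}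
    (h : Tendsto (fun n => ‖u n - T‖) atTop (𝓝 0)) (x : H) :
    Tendsto (fun n => u n x) atTop (𝓝 (T x)) := by
  rw [tendsto_iff_norm_sub_tendsto_zero]
  refine squeeze_zero (fun _ => norm_nonneg _) (fun n => ?_) (by simpa using h.mul_const ‖x‖)
  have := (toCLM (u n - T)).le_opNorm x
  rwa [norm_toCLM, map_sub, _root_.sub_apply] at this

/-- An adjointable operator has the polar decomposition as soon as the closures of its range and of
the range of its adjoint are orthogonally complemented. -/
theorem hasPolarDecomposition {C : AdjointableOp A H}
    (h : IsOrthogonallyComplemented A C.rangeClosure)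
    (h' : IsOrthogonallyComplemented A (star C).rangeClosure) : C.HasPolarDecomposition := by
  set k := CFC.abs C with hk
  have hk0 : 0 ≤ k := CFC.abs_nonneg C
  have hks : star k = k := hk0.isSelfAdjoint.star_eq
  have hkk : k * k = star C * C := CFC.abs_mul_abs C
  have hε (n : ℕ) : (0 : ℝ) < 1 / ((n : ℝ) + 1) := by positivity
  have hlim : Tendsto (fun n : ℕ => 1 / ((n : ℝ) + 1)) atTop (𝓝 0) :=
    tendsto_one_div_add_atTop_nhds_zero_nat
  -- `U` will be the pointwise limit of the contractions `C r_n = C (|C| + ε_n)⁻¹`.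
  choose r hrs hkr hone hnorm using fun n => exists_resolvent hk0 (hε n)
  set ε : ℕ → ℝ := fun n => 1 / ((n : ℝ) + 1)
  have hone' (n : ℕ) : r n * k = 1 - ε n • r n := by
    rw [← (hkr n).eq]; exact eq_sub_of_add_eq (hone n)
  have hu (n : ℕ) : ‖C * r n‖ ≤ 1 := by
    refine (norm_eq_of_star_mul_self_eq ?_).trans_le (hnorm n)
    rw [star_mul, star_mul, (hrs n).star_eq, hks, mul_assoc, ← mul_assoc (star C), ← hkk]
    simp only [mul_assoc]
  have hsu (n : ℕ) : star (C * r n) = r n * star C := by rw [star_mul, (hrs n).star_eq]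
  have hsu1 (n : ℕ) : ‖star (C * r n)‖ ≤ 1 := by rw [norm_star]; exact hu n
  have hsmall {v : ℕ → AdjointableOp A H} {T : AdjointableOp A H}
      (hv : ∀ n, ‖v n - T‖ ≤ ε n) (x : H) : Tendsto (fun n => v n x) atTop (𝓝 (T x)) :=
    tendsto_apply (squeeze_zero (fun _ => norm_nonneg _) hv hlim) x
  have hεn (n : ℕ) {T : AdjointableOp A H} (hT : ‖T‖ ≤ 1) : ‖-(ε n • T)‖ ≤ ε n := by
    rw [norm_neg, norm_smul, Real.norm_of_nonneg (hε n).le]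
    exact mul_le_of_le_one_right (hε n).le hT
  -- From `r_n k = 1 - ε_n r_n`, the error `C r_n k - C = -ε_n C r_n` has norm at most `ε_n`; the
  -- next two limits use the same estimate.
  have hlim1 (x : H) : Tendsto (fun n => (C * r n) (k x)) atTop (𝓝 (C x)) := by
    have := hsmall (v := fun n => C * r n * k) (T := C) (fun n => by
      rw [mul_assoc, hone', mul_sub, mul_one, mul_smul_comm, sub_sub_cancel_left]
      exact hεn n (hu n)) x
    simpa only [mul_apply _ k] using this
  have hlim2 (x : H) : Tendsto (fun n => (star (C * r n)) (C x)) atTop (𝓝 (k x)) := by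
    have := hsmall (v := fun n => star (C * r n) * C) (T := k) (fun n => by
      rw [hsu, mul_assoc, ← hkk, ← mul_assoc, hone', sub_mul, one_mul, smul_mul_assoc,
        sub_sub_cancel_left, ← (hkr n).eq]
      exact hεn n (hnorm n)) x
    simpa only [mul_apply _ C] using this
  have hlim3 (x : H) : Tendsto (fun n => (k * r n) (star C x)) atTop (𝓝 (star C x)) := by
    have := hsmall (v := fun n => k * r n * star C) (T := star C) (fun n => by
      rw [(hkr n).eq, hone', sub_mul, one_mul, smul_mul_assoc, sub_sub_cancel_left, ← hsu]
      exact hεn n (hsu1 n)) x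
    simpa only [mul_apply _ (star C)] using this
  have hCk : (star C).rangeClosure ≤ k.rangeClosure :=
    rangeClosure_le k.isClosed_rangeClosure fun x =>
      k.isClosed_rangeClosure.mem_of_tendsto (hlim3 x) <| .of_forall fun n => by
        rw [mul_apply]; exact k.apply_mem_rangeClosure _
  have hker {x : H} (hx : C x = 0) (n : ℕ) : (C * r n) x = 0 := by
    have hkx : k x = 0 := by
      refine CStarModule.inner_self.mp (?_ : inner A _ _ = 0)
      rw [inner_apply_left, hks, ← mul_apply, hkk, mul_apply, hx, map_zero,
        CStarModule.inner_zero_right]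
    have h1 : (C * (r n * k)) x = 0 := by rw [mul_apply, mul_apply, hkx, map_zero, map_zero]
    rw [hone', mul_sub, mul_one, mul_smul_comm, map_sub, _root_.sub_apply, hx,
      zero_sub, neg_eq_zero] at h1
    have h2 : ε n • ((C * r n) x) = 0 := h1
    exact (smul_eq_zero.mp h2).resolve_left (hε n).ne'
  have hker' {x : H} (hx : star C x = 0) (n : ℕ) : (star (C * r n)) x = 0 := by
    rw [hsu, mul_apply, hx, map_zero]
  -- The sequence converges on `R(k)`, so it is Cauchy on `cl R(C*)`, and it vanishes on the
  -- complement `ker C`. The adjoints are treated alike on `cl R(C)` and `ker C*`; both are needed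
  -- for the limit to be adjointable.
  have hcau (x : H) : CauchySeq fun n => (C * r n) x := by
    have hle : (star C).rangeClosure ≤ cauchySubmodule fun n => toCLM (C * r n) :=
      hCk.trans <| rangeClosure_le (isClosed_cauchySubmodule hu) fun x => (hlim1 x).cauchySeq
    obtain ⟨y, hy, hxy⟩ := isOrthogonallyComplemented_iff.mp h' x
    rw [mem_orthogonal_rangeClosure, star_star] at hxy
    have h0 : x - y ∈ cauchySubmodule fun n => toCLM (C * r n) := by
      change CauchySeq fun n => (C * r n) (x - y)
      simp only [hker hxy]
      exact cauchySeq_const 0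
    have := add_mem h0 (hle hy)
    rwa [sub_add_cancel] at this
  have hcau' (x : H) : CauchySeq fun n => (star (C * r n)) x := by
    have hle : C.rangeClosure ≤ cauchySubmodule fun n => toCLM (star (C * r n)) :=
      rangeClosure_le (isClosed_cauchySubmodule hsu1) fun x => (hlim2 x).cauchySeq
    obtain ⟨y, hy, hxy⟩ := isOrthogonallyComplemented_iff.mp h x
    rw [mem_orthogonal_rangeClosure] at hxy
    have h0 : x - y ∈ cauchySubmodule fun n => toCLM (star (C * r n)) := by
      change CauchySeq fun n => (star (C * r n)) (x - y)
      simp only [hker' hxy]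
      exact cauchySeq_const 0
    have := add_mem h0 (hle hy)
    rwa [sub_add_cancel] at this
  choose f hf using fun x => cauchySeq_tendsto_of_complete (hcau x)
  choose g hg using fun x => cauchySeq_tendsto_of_complete (hcau' x)
  have hcont : Continuous (fun z : H × H => inner A z.1 z.2) := CStarModule.continuous_inner
  have hfg (x y : H) : inner A (f x) y = inner A x (g y) := by
    have h1 := (hcont.tendsto (f x, y)).comp ((hf x).prodMk_nhds tendsto_const_nhds)
    have h2 := (hcont.tendsto (x, g y)).comp (tendsto_const_nhds.prodMk_nhds (hg y))
    exact tendsto_nhds_unique h1 (h2.congr fun n => (inner_apply_left (C * r n) x y).symm)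
  obtain ⟨U, hU⟩ := exists_eq_of_adjoint f g hfg
  have hU' (x : H) : star U x = g x := ext_inner (A := A) fun z => by
    rw [← inner_apply_left, hU, hfg]
  have hCU : C = U * k := op_ext fun x => by
    rw [mul_apply, hU]
    exact tendsto_nhds_unique (hlim1 x) (hf _)
  have hUC : star U * C = k := op_ext fun x => by
    rw [mul_apply, hU']
    exact tendsto_nhds_unique (hg _) (hlim2 x)
  have hUU : (star C).rangeClosure ≤
      LinearMap.eqLocus (toCLM (star U * U) : H →ₗ[ℂ] H) LinearMap.id :=
    hCk.trans <| rangeClosure_le (isClosed_eq (toCLM (star U * U)).continuous continuous_id)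
      fun x => by
        change (star U * U) (k x) = k x
        rw [← mul_apply, mul_assoc, ← hCU, hUC]
  obtain ⟨p, hp⟩ := exists_isProjectionOnto h'
  -- `1 - p` maps into `ker C`, where every `C r_n`, hence `U`, vanishes.
  have hUp : U * p = U := op_ext fun x => by
    have h0 : C (x - p x) = 0 := by
      have := hp.1.isSelfAdjoint.star_eq
      have h1 : star C = p * star C := op_ext fun x => by
        rw [mul_apply, hp.apply_eq (apply_mem_rangeClosure _ x)]
      have h2 : C = C * p := by
        rw [← star_inj, star_mul, this]; exact h1
      rw [map_sub, ← mul_apply, ← h2, sub_self]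
    have h1 : U (x - p x) = 0 := by
      rw [hU]
      refine tendsto_nhds_unique (hf _) ?_
      simp only [hker h0]
      exact tendsto_const_nhds
    rw [map_sub, sub_eq_zero] at h1
    rw [mul_apply, h1]
  have hpU : star U * U = p := op_ext fun x => by
    calc (star U * U) x = (star U * U) (p x) := by
          rw [← mul_apply _ p, mul_assoc, hUp]
      _ = p x := hUU (hp.apply_mem x)
  refine ⟨U, ?_, hCU, ?_⟩
  · rw [mul_assoc, hpU, hUp]
  · rw [hpU]; exact hp

end AdjointableOp
end Module
-- Polar decompositions attached to a quasi-projection pair.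
section Pairs

variable {A H : Type*} [NonUnitalCStarAlgebra A] [PartialOrder A] [StarOrderedRing A]
  [NormedAddCommGroup H] [NormedSpace ℂ H] [SMul A H] [CStarModule A H] [CompleteSpace H]

open AdjointableOp

theorem IsQuasiProjectionPair.one_sub_right {R : Type*} [CStarAlgebra R] [PartialOrder R]
    [StarOrderedRing R] {p q : R} (h : IsQuasiProjectionPair p q) :
    IsQuasiProjectionPair p (1 - q) := by
  refine isQuasiProjectionPair_of_isSelfAdjoint h.isStarProjection h.isIdempotentElem.one_sub ?_
  have : 2 * (p * (1 - q)) - (1 - q) = (p + p) - 1 - (2 * (p * q) - q) := by noncomm_ring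
  have hp := h.isStarProjection.isSelfAdjoint
  rw [this]
  exact ((hp.add hp).sub (IsSelfAdjoint.one R)).sub h.isSelfAdjoint

namespace IsQuasiProjectionPair

variable {P Q : AdjointableOp A H}

theorem rangeClosure_one_sub_mul (hg : ∃ g, Q * P * g = Q) :
    ((1 - P) * Q).rangeClosure = ((1 - P) * Q * P).rangeClosure := by
  obtain ⟨g, hg⟩ := hg
  refine le_antisymm ?_ (rangeClosure_mul_le _ _)
  nth_rw 1 [← hg]
  rw [← mul_assoc, ← mul_assoc]
  exact rangeClosure_mul_le _ _

/-- The range closure is that of `(1 - P) Q P`. The adjoint equals `-(2P - 1) Q (1 - P)`, and `Q = g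
P Q` recovers it from `P Q (1 - P)` by left multiplication. -/
theorem hasPolarDecomposition_one_sub_mul (h : IsQuasiProjectionPair P Q)
    (hg : ∃ g, Q * P * g = Q)
    (h1 : IsOrthogonallyComplemented A (P * Q * (1 - P)).rangeClosure)
    (h2 : IsOrthogonallyComplemented A ((1 - P) * Q * P).rangeClosure) :
    ((1 - P) * Q).HasPolarDecomposition := by
  refine hasPolarDecomposition (by rwa [rangeClosure_one_sub_mul hg]) ?_
  obtain ⟨g, hg⟩ := h.exists_mul_mul_eq_of_right hg
  have hPP : P * P = P := h.isStarProjection.isIdempotentElem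
  have hs : star ((1 - P) * Q) = star Q * (1 - P) := by
    rw [star_mul, h.isStarProjection.one_sub.isSelfAdjoint.star_eq]
  have hS : (2 * P - 1) * (1 - P) = -(1 - P) := by
    calc (2 * P - 1) * (1 - P) = -(2 * (P * P)) + 3 * P - 1 := by noncomm_ring
      _ = -(1 - P) := by rw [hPP]; noncomm_ring
  have e1 : star Q * (1 - P) = -((2 * P - 1) * Q * (1 - P)) := by
    rw [← h.star_mul_eq, mul_assoc, hS, mul_neg, neg_neg]
  rw [hs]
  refine isOrthogonallyComplemented_of_mul_eq (a := -((2 * P - 1) * g))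
    (b := -(P * (2 * P - 1))) ?_ ?_ h1
  · calc star Q * (1 - P) = -((2 * P - 1) * (g * P * Q) * (1 - P)) := by rw [hg, e1]
      _ = _ := by simp only [neg_mul, mul_assoc]
  · calc P * Q * (1 - P) = P * ((2 * P - 1) * (2 * P - 1)) * Q * (1 - P) := by
          rw [h.reflection_mul_self, mul_one]
      _ = _ := by rw [e1]; simp only [neg_mul, mul_neg, neg_neg, mul_assoc]

/-- `Q` is a left multiple of `P Q`, so complementedness passes from `cl R(Q)`. The adjoint is `(2P
- 1) Q P`, with the same range closure as `(2P - 1) Q`, an invertible left multiple of `Q`. -/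
theorem hasPolarDecomposition_mul (h : IsQuasiProjectionPair P Q) (hg : ∃ g, Q * P * g = Q) :
    (P * Q).HasPolarDecomposition := by
  have hPP : P * P = P := h.isStarProjection.isIdempotentElem
  have hQ := isOrthogonallyComplemented_of_isIdempotentElem h.isIdempotentElem
  have hr := h.reflection_mul_self
  refine hasPolarDecomposition ?_ ?_
  · obtain ⟨g, hg⟩ := h.exists_mul_mul_eq_of_right hg
    exact isOrthogonallyComplemented_of_mul_eq rfl (by rw [← mul_assoc, hg]) hQ
  · obtain ⟨g, hg⟩ := hg
    have hS : (2 * P - 1) * P = P := by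
      calc (2 * P - 1) * P = 2 * (P * P) - P := by noncomm_ring
        _ = P := by rw [hPP]; noncomm_ring
    have hs : star (P * Q) = (2 * P - 1) * Q * P := by
      rw [star_mul, h.isStarProjection.isSelfAdjoint.star_eq, ← h.star_mul_eq, mul_assoc, hS]
    have hc : ((2 * P - 1) * Q * P).rangeClosure = ((2 * P - 1) * Q).rangeClosure := by
      refine le_antisymm (rangeClosure_mul_le _ _) ?_
      nth_rw 1 [← hg]
      rw [← mul_assoc, ← mul_assoc]
      exact rangeClosure_mul_le _ _
    rw [hs, hc]
    exact isOrthogonallyComplemented_of_mul_eq (b := 2 * P - 1) rfl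
      (by rw [← mul_assoc, hr, one_mul]) hQ

end IsQuasiProjectionPair
end Pairs
end HilbertCStar

open HilbertCStar HilbertCStar.AdjointableOp in
/-- Let `H` be a Hilbert C*-module over a C*-algebra `A` and `Q` an adjointable idempotent on `H`.
The matched pair `(m(Q), Q)` is harmonious if and only if it is semi-harmonious; moreover
`(m(Q), I - Q)` is always semi-harmonious. -/
theorem mainTheorem4 {A H : Type*} [NonUnitalCStarAlgebra A] [PartialOrder A] [StarOrderedRing A]
    [NormedAddCommGroup H] [NormedSpace ℂ H] [SMul A H] [CStarModule A H] [CompleteSpace H]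
    (Q : HilbertCStar.AdjointableOp A H) (hQ : IsIdempotentElem Q) :
    (HilbertCStar.IsHarmonious (HilbertCStar.matchedProjection Q) Q ↔
      HilbertCStar.IsSemiHarmonious (HilbertCStar.matchedProjection Q) Q) ∧
    HilbertCStar.IsSemiHarmonious (HilbertCStar.matchedProjection Q) (1 - Q) := by
  obtain ⟨h, hg, hg'⟩ := matched_pair hQ (m := matchedProjection Q) rfl
  generalize matchedProjection Q = P at *
  have hg := h.exists_mul_mul_eq_of_left hg
  have hPP : P * P = P := h.isStarProjection.isIdempotentElem
  have e1 : P * (1 - Q) * (1 - P) = -(P * Q * (1 - P)) := by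
    calc P * (1 - Q) * (1 - P) = P - P * P - P * Q * (1 - P) := by noncomm_ring
      _ = _ := by rw [hPP, sub_self, zero_sub]
  have e2 : (1 - P) * (1 - Q) * P = -((1 - P) * Q * P) := by
    calc (1 - P) * (1 - Q) * P = P - P * P - (1 - P) * Q * P := by noncomm_ring
      _ = _ := by rw [hPP, sub_self, zero_sub]
  have hc := IsQuasiProjectionPair.rangeClosure_one_sub_mul hg'
  rw [sub_sub_cancel, e1, rangeClosure_neg] at hc
  refine ⟨⟨fun hh => ⟨h, ?_, ?_⟩, fun hs => ⟨h, ?_, ?_⟩⟩, h.one_sub_right, ?_, ?_⟩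
  -- Passing to the pair `(1 - P, 1 - Q)` swaps the two off-diagonal corners up to sign.
  · have := h.one_sub.hasPolarDecomposition_one_sub_mul hg'
    rw [sub_sub_cancel, e1, e2, rangeClosure_neg, rangeClosure_neg] at this
    exact this hh.complemented_right hh.complemented_left
  · exact h.hasPolarDecomposition_one_sub_mul hg hh.complemented_left hh.complemented_right
  · exact hc ▸ hs.polar_left.isOrthogonallyComplemented
  · exact IsQuasiProjectionPair.rangeClosure_one_sub_mul hg ▸
      hs.polar_right.isOrthogonallyComplemented
  · rw [sub_sub_cancel]
    exact h.hasPolarDecomposition_mul hg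
  · exact h.one_sub.hasPolarDecomposition_mul hg'
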